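/- Let $p\ge 2$. Let $\mathbb{M}^{\ge}$ (resp. $\mathbb{M}^{>}$) be the set of symmetric non-negative definite (resp. positive definite) real $p\times p$ matrices, let $\lambda_{\min},\lambda_{\max}$ denote extreme eigenvalues and let $\|M\|=\mathrm{tr}^{1/2}(MM^\top)$. Let $\mu$ be a probability measure on a set $\mathscr{X}\subseteq\mathbb{R}^d$ and let $\mathscr{M}:\mathscr{X}\to\mathbb{M}^{\ge}$ and $\Phi:\mathbb{M}^{\ge}\to\mathbb{R}\cup\{-\infty\}$ satisfy the following. (H$_\Phi$) $\Phi$ is finite and strictly concave on $\mathbb{M}^{>}$, and non-decreasing on $\mathbb{M}^{\ge}$ for the Loewner ordering. There is a gradient $\nabla_\Phi:\mathbb{M}^{>}\to\mathbb{M}^{\ge}$ such that for all $M\in\mathbb{M}^{>}$ and $M'\in\mathbb{M}^{\ge}$ $$\lim_{\gamma\to0^+}\frac{\Phi[(1-\gamma)M+\gamma M']-\Phi(M)}{\gamma}=\mathrm{tr}[\nabla_\Phi(M)(M'-M)].$$ There are $A(\ell)<\infty$ and $a(L)>0$ such that, for all $0<\ell\le L$ and all $M\in\mathbb{M}^{\ge}$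 with $\ell<\lambda_{\min}(M)$ and $\lambda_{\max}(M)<L$, $\|\nabla_\Phi(M)\|<A(\ell)$ and $\lambda_{\min}[\nabla_\Phi(M)]>a(L)$. For every $\ell>0$ there is $K_\ell<\infty$ such that $\|\nabla_\Phi(M_2)-\nabla_\Phi(M_1)\|\le K_\ell\|M_2-M_1\|$ for all $M_1,M_2\in\mathbb{M}^{\ge}$ with $\lambda_{\min}(M_1),\lambda_{\min}(M_2)>\ell$. (H$_{\mathscr{M}}$) (i) $\mathscr{M}$ is continuous on $\mathscr{X}$ and $\int_{\mathscr{X}}\|\mathscr{M}(x)\|^2\,\mu(dx)<\infty$; (ii) for every $\epsilon>0$ there is $\ell_\epsilon>0$ such that $\lambda_{\min}\{\int_{A}\mathscr{M}(x)\,\mu(dx)\}>\ell_\epsilon$ for every measurable $A\subseteq\mathscr{X}$ with $\mu(A)=\epsilon$. Let $\alpha\in(0,1)$ and let $$\mathbb{M}(\alpha)=\Big\{\int_{\mathscr{X}}\mathscr{M}(x)\,\xi(dx):\ \xi\text{ a probability measure on }\mathscr{X},\ \xi\le\mu/\alpha\Big\}.$$ Then $\Phi$ has a unique maximizer $M_\alpha^*$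 over $\mathbb{M}(\alpha)$. Moreover, let $X_1,X_2,\dots$ be i.i.d. random variables with law $\mu$. Almost surely, for every sequence of integers $n_k\le k$ with $n_k/k\to\alpha$ and every choice, for each $k$, of a set $S_k\subseteq\{1,\dots,k\}$ of $n_k$ indices, the matrices $M_{n_k,k}=\frac1{n_k}\sum_{i\in S_k}\mathscr{M}(X_i)$ satisfy $$\limsup_{k\to\infty}\Phi(M_{n_k,k})\le\Phi(M_\alpha^*).$$ Thus no selection rule, sequential or not, can asymptotically beat the optimal bounded design measure. -/

import Mathlib

open MeasureTheory ProbabilityTheory Filter Topology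

namespace BoundedDesign

noncomputable section

/-- Smallest eigenvalue of a (nonempty, symmetric) matrix. -/
def lamMin {p : ℕ} (M : Matrix (Fin p) (Fin p) ℝ) : ℝ := sInf (spectrum ℝ M)

/-- Largest eigenvalue of a (nonempty, symmetric) matrix. -/
def lamMax {p : ℕ} (M : Matrix (Fin p) (Fin p) ℝ) : ℝ := sSup (spectrum ℝ M)

/-- The Frobenius norm `tr^{1/2}(M Mᵀ)`. -/
def frob {p : ℕ} (M : Matrix (Fin p) (Fin p) ℝ) : ℝ := Real.sqrt (M * M.transpose).trace

/-- Nonnegative definite matrices whose eigenvalues all lie strictly between `l` and `L`. -/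
def eigenBand (p : ℕ) (l L : ℝ) : Set (Matrix (Fin p) (Fin p) ℝ) :=
  {M | M.PosSemidef ∧ l < lamMin M ∧ lamMax M < L}

/-- `G` is the gradient of `Φ` on the positive definite cone: it takes values in the nonnegative
definite matrices, and the one-sided directional derivative of `Φ` at `M` towards `M'` is
`tr (G M (M' - M))` for all positive definite `M` and nonnegative definite `M'`. -/
def IsGradient {p : ℕ} (Φ : Matrix (Fin p) (Fin p) ℝ → EReal)
    (G : Matrix (Fin p) (Fin p) ℝ → Matrix (Fin p) (Fin p) ℝ) : Prop :=
  ∀ M : Matrix (Fin p) (Fin p) ℝ, M.PosDef →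
    (G M).PosSemidef ∧
    ∀ M' : Matrix (Fin p) (Fin p) ℝ, M'.PosSemidef →
      Tendsto
        (fun γ : ℝ => ((Φ ((1 - γ) • M + γ • M')).toReal - (Φ M).toReal) / γ)
        (𝓝[>] 0) (𝓝 (G M * (M' - M)).trace)

/-- The assumptions on the design criterion `Φ`. Only the values of `Φ` at nonnegative definite
matrices matter; they lie in `ℝ ∪ {-∞}`, and are finite at positive definite matrices. -/
structure HPhi {p : ℕ} (Φ : Matrix (Fin p) (Fin p) ℝ → EReal) : Prop where
  ne_top : ∀ M : Matrix (Fin p) (Fin p) ℝ, M.PosSemidef → Φ M ≠ ⊤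
  ne_bot : ∀ M : Matrix (Fin p) (Fin p) ℝ, M.PosDef → Φ M ≠ ⊥
  strictConcave :
    StrictConcaveOn ℝ {M : Matrix (Fin p) (Fin p) ℝ | M.PosDef} (fun M => (Φ M).toReal)
  increasing : ∀ M₁ M₂ : Matrix (Fin p) (Fin p) ℝ, M₁.PosSemidef → M₂.PosSemidef →
    (M₂ - M₁).PosSemidef → Φ M₁ ≤ Φ M₂
  gradient : ∃ G : Matrix (Fin p) (Fin p) ℝ → Matrix (Fin p) (Fin p) ℝ,
    IsGradient Φ G ∧
    (∃ A a : ℝ → ℝ, (∀ L : ℝ, 0 < L → 0 < a L) ∧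
      ∀ l L : ℝ, 0 < l → l ≤ L → ∀ M ∈ eigenBand p l L,
        frob (G M) < A l ∧ a L < lamMin (G M)) ∧
    (∀ l : ℝ, 0 < l → ∃ K : ℝ, ∀ M₁ M₂ : Matrix (Fin p) (Fin p) ℝ,
      M₁.PosSemidef → M₂.PosSemidef → l < lamMin M₁ → l < lamMin M₂ →
        frob (G M₂ - G M₁) ≤ K * frob (M₂ - M₁))

/-- The information matrix `∫ ℳ(x) ξ(dx)` (entrywise integral). -/
def infoMatrix {E : Type*} [MeasurableSpace E] {p : ℕ} (ℳ : E → Matrix (Fin p) (Fin p) ℝ)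
    (ξ : Measure E) : Matrix (Fin p) (Fin p) ℝ :=
  Matrix.of fun i j => ∫ x, ℳ x i j ∂ξ

/-- The assumptions on the elementary information matrices `ℳ(x)`. The bound `l` may depend on the
measure `ε` of the subset, but not on the subset. -/
structure HM {E : Type*} [TopologicalSpace E] [MeasurableSpace E] {p : ℕ} (μ : Measure E)
    (ℳ : E → Matrix (Fin p) (Fin p) ℝ) : Prop where
  continuous : Continuous ℳ
  sq_integrable : Integrable (fun x => frob (ℳ x) ^ 2) μ
  nondegenerate : ∀ ε : ℝ, 0 < ε → ∃ l : ℝ, 0 < l ∧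
    ∀ A : Set E, MeasurableSet A → μ A = ENNReal.ofReal ε →
      l < lamMin (infoMatrix ℳ (μ.restrict A))

/-- The information matrices of the bounded design measures of level `α`: the probability
measures `ξ` with `ξ ≤ μ / α`. -/
def boundedInfo {E : Type*} [MeasurableSpace E] {p : ℕ} (μ : Measure E)
    (ℳ : E → Matrix (Fin p) (Fin p) ℝ) (α : ℝ) : Set (Matrix (Fin p) (Fin p) ℝ) :=
  {M | ∃ ξ : Measure E, ξ Set.univ = 1 ∧ ξ ≤ (ENNReal.ofReal α)⁻¹ • μ ∧ M = infoMatrix ℳ ξ}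

/-- `Mopt` maximizes `Φ` over the information matrices of bounded design measures. -/
def IsOptimal {E : Type*} [MeasurableSpace E] {p : ℕ} (Φ : Matrix (Fin p) (Fin p) ℝ → EReal)
    (μ : Measure E) (ℳ : E → Matrix (Fin p) (Fin p) ℝ) (α : ℝ)
    (Mopt : Matrix (Fin p) (Fin p) ℝ) : Prop :=
  Mopt ∈ boundedInfo μ ℳ α ∧ ∀ M ∈ boundedInfo μ ℳ α, Φ M ≤ Φ Mopt

/-- The normalized information matrix of the points `x i`, `i ∈ S`. -/
def selectedInfo {E : Type*} {p : ℕ} (ℳ : E → Matrix (Fin p) (Fin p) ℝ) (x : ℕ → E)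
    (S : Finset ℕ) : Matrix (Fin p) (Fin p) ℝ :=
  (S.card : ℝ)⁻¹ • ∑ i ∈ S, ℳ (x i)

end

end BoundedDesign

/-! Concavity puts the graph of `Φ` below its tangent plane at the optimum `M₀`. With `g x = (G M₀ *
ℳ x).trace`, a selected matrix can therefore beat `M₀` only if the mean of `g` over the chosen
points exceeds `(G M₀ * M₀).trace`. For every `c` that mean is at most `c` plus `1 / n k` times the
sum of `(g - c)⁺` over all the first `k` points (`sum_le_card_mul_add_sum_max`), a bound that sees
the selection only through its size. By the strong law it tends to `c + E[(g - c)⁺] / α`. When `c`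
is an upper `α`-quantile of `g`, this limit is the integral of `g` against a bounded design measure
(`exists_measure_integral_eq`), and first-order optimality of `M₀` bounds it by `(G M₀ * M₀).trace`.

The optimum exists because the bounded information matrices form a compact set of positive definite
matrices, on which `Φ` is upper semicontinuous. It is unique by convexity of that set and strict
concavity. -/

namespace BoundedDesign

/-! ### Bounded information matrices: positivity, convexity, weak-* compactness. -/

section Measures

variable {E : Type*} [MeasurableSpace E] {p : ℕ}

lemma posDef_of_lt_lamMin {M : Matrix (Fin p) (Fin p) ℝ} (hM : M.IsHermitian) {l : ℝ}
    (hl : 0 ≤ l) (h : l < lamMin M) : M.PosDef := by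
  refine hM.posDef_iff_eigenvalues_pos.2 fun i => ?_
  have hfin : (spectrum ℝ M).Finite := by
    rw [hM.spectrum_real_eq_range_eigenvalues]; exact Set.finite_range _
  exact (hl.trans_lt h).trans_le (csInf_le hfin.bddBelow (hM.eigenvalues_mem_spectrum_real i))

lemma sq_entry_le_frob_sq (M : Matrix (Fin p) (Fin p) ℝ) (i j : Fin p) :
    M i j ^ 2 ≤ frob M ^ 2 := by
  have h : (M * M.transpose).trace = ∑ i, ∑ j, M i j ^ 2 := by
    simp [Matrix.trace, Matrix.mul_apply, sq]
  have h0 : 0 ≤ ∑ i, ∑ j, M i j ^ 2 := by positivity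
  rw [frob, h, Real.sq_sqrt h0]
  calc M i j ^ 2 ≤ ∑ j, M i j ^ 2 :=
        Finset.single_le_sum (f := fun j => M i j ^ 2) (fun _ _ => sq_nonneg _) (Finset.mem_univ j)
    _ ≤ _ := Finset.single_le_sum (f := fun i => ∑ j, M i j ^ 2) (fun _ _ => by positivity)
        (Finset.mem_univ i)

lemma HM.memLp [TopologicalSpace E] [BorelSpace E] {μ : Measure E}
    {ℳ : E → Matrix (Fin p) (Fin p) ℝ} (hM : HM μ ℳ) (i j : Fin p) :
    MemLp (fun x => ℳ x i j) 2 μ := by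
  have hc : Continuous fun x => ℳ x i j := hM.continuous.matrix_elem i j
  refine (memLp_two_iff_integrable_sq hc.measurable.aestronglyMeasurable).2 ?_
  refine hM.sq_integrable.mono' (hc.measurable.pow_const 2).aestronglyMeasurable ?_
  refine ae_of_all _ fun x => ?_
  rw [Real.norm_of_nonneg (sq_nonneg _)]
  exact sq_entry_le_frob_sq _ i j

lemma integrable_of_le_smul {μ ξ : Measure E} {c : ℝ} (h : ξ ≤ ENNReal.ofReal c • μ) {f : E → ℝ}
    (hf : Integrable f μ) : Integrable f ξ :=
  (hf.smul_measure ENNReal.ofReal_ne_top).mono_measure h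

lemma integrable_trace_mul {ξ : Measure E} {ℳ : E → Matrix (Fin p) (Fin p) ℝ}
    (h : ∀ i j, Integrable (fun x => ℳ x i j) ξ) (B : Matrix (Fin p) (Fin p) ℝ) :
    Integrable (fun x => (B * ℳ x).trace) ξ := by
  simp only [Matrix.trace, Matrix.mul_apply, Matrix.diag]
  exact integrable_finsetSum _ fun i _ => integrable_finsetSum _ fun j _ => (h j i).const_mul _

lemma trace_mul_infoMatrix {ξ : Measure E} {ℳ : E → Matrix (Fin p) (Fin p) ℝ}
    (h : ∀ i j, Integrable (fun x => ℳ x i j) ξ) (B : Matrix (Fin p) (Fin p) ℝ) :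
    (B * infoMatrix ℳ ξ).trace = ∫ x, (B * ℳ x).trace ∂ξ := by
  have hB : ∀ N : Matrix (Fin p) (Fin p) ℝ, (B * N).trace = ∑ i, ∑ j, B i j * N j i := fun N => by
    simp [Matrix.trace, Matrix.mul_apply]
  have hi : ∀ i j, Integrable (fun x => B i j * ℳ x j i) ξ := fun i j => (h j i).const_mul _
  simp only [hB]
  rw [integral_finsetSum _ fun i _ => integrable_finsetSum _ fun j _ => hi i j]
  refine Finset.sum_congr rfl fun i _ => ?_
  rw [integral_finsetSum _ fun j _ => hi i j]
  exact Finset.sum_congr rfl fun j _ => (integral_const_mul _ _).symm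

lemma dotProduct_mulVec_eq_trace (v : Fin p → ℝ) (M : Matrix (Fin p) (Fin p) ℝ) :
    star v ⬝ᵥ M.mulVec v = (Matrix.vecMulVec v v * M).trace := by
  rw [Matrix.trace_mul_comm, Matrix.mul_vecMulVec, Matrix.trace_vecMulVec, dotProduct_comm]
  simp

lemma isHermitian_infoMatrix {ξ : Measure E} {ℳ : E → Matrix (Fin p) (Fin p) ℝ}
    (hpsd : ∀ x, (ℳ x).PosSemidef) : (infoMatrix ℳ ξ).IsHermitian := by
  ext i j
  simp only [Matrix.conjTranspose_apply, infoMatrix, Matrix.of_apply, star_trivial]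
  exact integral_congr_ae (ae_of_all _ fun x => by simpa using (hpsd x).1.apply i j)

/-- If the quadratic form vanished at some `v ≠ 0`, then `v` would annihilate `ℳ x` on a set `N` of
full `ξ`-measure. Domination by `μ` gives `μ N > 0`, which contradicts nondegeneracy with `ε = μ N`.
-/
lemma posDef_infoMatrix [TopologicalSpace E] [BorelSpace E] {μ : Measure E}
    [IsProbabilityMeasure μ] {ℳ : E → Matrix (Fin p) (Fin p) ℝ} (hpsd : ∀ x, (ℳ x).PosSemidef)
    (hM : HM μ ℳ) {c : ℝ} {ξ : Measure E} (hξ : ξ Set.univ = 1) (hle : ξ ≤ ENNReal.ofReal c • μ) :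
    (infoMatrix ℳ ξ).PosDef := by
  have hint : ∀ i j, Integrable (fun x => ℳ x i j) μ := fun i j =>
    (hM.memLp i j).integrable one_le_two
  have hintξ : ∀ i j, Integrable (fun x => ℳ x i j) ξ := fun i j =>
    integrable_of_le_smul hle (hint i j)
  have hH := fun ν : Measure E => isHermitian_infoMatrix (ξ := ν) hpsd
  refine Matrix.PosDef.of_dotProduct_mulVec_pos (hH ξ) fun v hv => ?_
  rw [dotProduct_mulVec_eq_trace, trace_mul_infoMatrix hintξ]
  have hnn : ∀ x, 0 ≤ (Matrix.vecMulVec v v * ℳ x).trace := fun x => by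
    rw [← dotProduct_mulVec_eq_trace]; exact (hpsd x).dotProduct_mulVec_nonneg v
  have hcont : Continuous fun x => (Matrix.vecMulVec v v * ℳ x).trace :=
    (continuous_const.matrix_mul hM.continuous).matrix_trace
  refine (integral_nonneg hnn).lt_of_ne' fun h0 => ?_
  rw [integral_eq_zero_iff_of_nonneg hnn (integrable_trace_mul hintξ _)] at h0
  set N : Set E := {x | (Matrix.vecMulVec v v * ℳ x).trace = 0} with hN
  have hNm : MeasurableSet N := hcont.measurable (measurableSet_singleton 0)
  have hξN : ξ N = 1 := by
    rw [← hξ]; exact measure_congr (eventuallyEq_univ.2 h0)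
  have hμN : μ N ≠ 0 := fun h => by
    have := hle N
    simp [hξN, h] at this
  obtain ⟨l, hl, hA⟩ := hM.nondegenerate (μ N).toReal
    (ENNReal.toReal_pos hμN (measure_ne_top _ _))
  have hpd := posDef_of_lt_lamMin (hH _) hl.le
    (hA N hNm (ENNReal.ofReal_toReal (measure_ne_top _ _)).symm)
  have h1 := hpd.dotProduct_mulVec_pos hv
  rw [dotProduct_mulVec_eq_trace, trace_mul_infoMatrix fun i j => (hint i j).restrict,
    setIntegral_congr_fun hNm (g := fun _ => (0 : ℝ)) fun x hx => hx] at h1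
  simp at h1

lemma convex_boundedInfo {μ : Measure E} {ℳ : E → Matrix (Fin p) (Fin p) ℝ}
    (hint : ∀ i j, Integrable (fun x => ℳ x i j) μ) {α : ℝ} (hα : 0 < α) :
    Convex ℝ (boundedInfo μ ℳ α) := by
  rintro _ ⟨ξ₁, h₁, hle₁, rfl⟩ _ ⟨ξ₂, h₂, hle₂, rfl⟩ a b ha hb hab
  refine ⟨ENNReal.ofReal a • ξ₁ + ENNReal.ofReal b • ξ₂, ?_, ?_, ?_⟩
  · simp [h₁, h₂, ← ENNReal.ofReal_add ha hb, hab]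
  · calc ENNReal.ofReal a • ξ₁ + ENNReal.ofReal b • ξ₂
        ≤ ENNReal.ofReal a • ((ENNReal.ofReal α)⁻¹ • μ)
          + ENNReal.ofReal b • ((ENNReal.ofReal α)⁻¹ • μ) := by gcongr
      _ = (ENNReal.ofReal α)⁻¹ • μ := by
        rw [← add_smul, ← ENNReal.ofReal_add ha hb, hab]; simp
  · rw [← ENNReal.ofReal_inv_of_pos hα] at hle₁ hle₂
    ext i j
    simp only [infoMatrix, Matrix.add_apply, Matrix.smul_apply, Matrix.of_apply]
    rw [integral_add_measure
      ((integrable_of_le_smul hle₁ (hint i j)).smul_measure ENNReal.ofReal_ne_top)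
      ((integrable_of_le_smul hle₂ (hint i j)).smul_measure ENNReal.ofReal_ne_top),
      integral_smul_measure, integral_smul_measure, ENNReal.toReal_ofReal ha,
      ENNReal.toReal_ofReal hb]

/-- The functionals on `L²(μ)` given by integration against probability densities bounded
by `c`. -/
def boundedDensities (μ : Measure E) [IsFiniteMeasure μ] (c : ℝ) :
    Set (WeakDual ℝ (Lp ℝ 2 μ)) :=
  WeakDual.toStrongDual ⁻¹' Metric.closedBall 0 c ∩
    ({φ | ∀ (A : Set E) (hA : MeasurableSet A),
        0 ≤ φ (indicatorConstLp 2 hA (measure_ne_top μ A) 1) ∧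
        φ (indicatorConstLp 2 hA (measure_ne_top μ A) 1) ≤ c * μ.real A} ∩
      {φ | φ (indicatorConstLp 2 MeasurableSet.univ (measure_ne_top μ _) 1) = 1})

/-- Banach–Alaoglu: every other constraint tests the functional on a fixed vector, so it is weak-*
closed. -/
lemma isCompact_boundedDensities (μ : Measure E) [IsFiniteMeasure μ] (c : ℝ) :
    IsCompact (boundedDensities μ c) := by
  refine (WeakDual.isCompact_closedBall 0 c).inter_right ?_
  refine IsClosed.inter ?_ (isClosed_eq (WeakDual.eval_continuous _) continuous_const)
  have h : ∀ (A : Set E) (hA : MeasurableSet A), IsClosed {φ : WeakDual ℝ (Lp ℝ 2 μ) |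
      0 ≤ φ (indicatorConstLp 2 hA (measure_ne_top μ A) 1) ∧
        φ (indicatorConstLp 2 hA (measure_ne_top μ A) 1) ≤ c * μ.real A} := fun A hA =>
    (isClosed_le continuous_const (WeakDual.eval_continuous _)).inter
      (isClosed_le (WeakDual.eval_continuous _) continuous_const)
  simpa only [← Set.ofPred_forall] using isClosed_iInter fun A => isClosed_iInter (h A)

/-- The Riesz representative of `φ` is the density; the constraints on indicators give its sign, its
bound and its total mass. -/
lemma exists_measure_of_mem_boundedDensities {μ : Measure E} [IsProbabilityMeasure μ] {c : ℝ}
    (hc : 0 ≤ c) {φ : WeakDual ℝ (Lp ℝ 2 μ)} (hφ : φ ∈ boundedDensities μ c) :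
    ∃ ξ : Measure E, ξ Set.univ = 1 ∧ ξ ≤ ENNReal.ofReal c • μ ∧
      ∀ (g : E → ℝ) (hg : MemLp g 2 μ), φ (hg.toLp g) = ∫ x, g x ∂ξ := by
  obtain ⟨f, rfl⟩ : ∃ f : Lp ℝ 2 μ, StrongDual.toWeakDual (InnerProductSpace.toDual ℝ _ f) = φ :=
    ⟨(InnerProductSpace.toDual ℝ _).symm (WeakDual.toStrongDual φ), by simp⟩
  have happ : ∀ g : Lp ℝ 2 μ, StrongDual.toWeakDual (InnerProductSpace.toDual ℝ _ f) g
      = inner ℝ f g := fun g => rfl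
  obtain ⟨-, hA, h1⟩ := hφ
  have hset : ∀ (A : Set E) (hA : MeasurableSet A),
      inner ℝ f (indicatorConstLp 2 hA (measure_ne_top μ A) 1) = ∫ x in A, f x ∂μ := by
    intro A hA
    rw [real_inner_comm, L2.inner_indicatorConstLp_one]
  simp only [Set.mem_ofPred_eq, happ, hset] at hA h1 ⊢
  have hfi : Integrable f μ := (Lp.memLp f).integrable one_le_two
  have hnn : 0 ≤ᵐ[μ] f := ae_nonneg_of_forall_setIntegral_nonneg hfi fun s hs _ => (hA s hs).1
  have hmeas : Measurable f := (Lp.stronglyMeasurable f).measurable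
  have hξ : ∀ A, MeasurableSet A → μ.withDensity (fun x => ENNReal.ofReal (f x)) A
      = ENNReal.ofReal (∫ x in A, f x ∂μ) := by
    intro A hA
    rw [withDensity_apply _ hA,
      ofReal_integral_eq_lintegral_ofReal hfi.restrict (ae_restrict_of_ae hnn)]
  refine ⟨μ.withDensity fun x => ENNReal.ofReal (f x), ?_, ?_, ?_⟩
  · rw [hξ _ .univ, h1, ENNReal.ofReal_one]
  · refine Measure.le_iff.2 fun s hs => ?_
    rw [hξ s hs, Measure.smul_apply, smul_eq_mul, ← ofReal_measureReal, ← ENNReal.ofReal_mul hc]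
    exact ENNReal.ofReal_le_ofReal (hA s hs).2
  · intro g hg
    rw [integral_withDensity_eq_integral_toReal_smul hmeas.ennreal_ofReal
      (ae_of_all _ fun _ => ENNReal.ofReal_lt_top), L2.inner_def]
    refine integral_congr_ae ?_
    filter_upwards [hg.coeFn_toLp, hnn] with x hx hx0
    simp only [hx, ENNReal.toReal_ofReal hx0]
    simp [mul_comm]

lemma exists_mem_boundedDensities_of_measure {μ : Measure E} [IsProbabilityMeasure μ] {c : ℝ}
    (hc : 0 ≤ c) {ξ : Measure E} (hξ : ξ Set.univ = 1) (hle : ξ ≤ ENNReal.ofReal c • μ) :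
    ∃ φ ∈ boundedDensities μ c,
      ∀ (g : E → ℝ) (hg : MemLp g 2 μ), φ (hg.toLp g) = ∫ x, g x ∂ξ := by
  have : IsProbabilityMeasure ξ := ⟨hξ⟩
  have hac : ξ ≪ μ := (Measure.absolutelyContinuous_of_le hle).trans
    (Measure.smul_absolutelyContinuous)
  have hbd : ξ.rnDeriv μ ≤ᵐ[μ] fun _ => ENNReal.ofReal c := by
    refine ae_le_of_forall_setLIntegral_le_of_sigmaFinite (Measure.measurable_rnDeriv _ _)
      fun s hs _ => ?_
    refine (Measure.setLIntegral_rnDeriv_le s).trans ((hle s).trans ?_)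
    simp
  have hbd' : ∀ᵐ x ∂μ, ‖(ξ.rnDeriv μ x).toReal‖ ≤ c := by
    filter_upwards [hbd] with x hx
    rw [Real.norm_of_nonneg ENNReal.toReal_nonneg]
    exact ENNReal.toReal_le_of_le_ofReal hc hx
  have hf : MemLp (fun x => (ξ.rnDeriv μ x).toReal) 2 μ :=
    MemLp.of_bound (Measure.measurable_rnDeriv _ _).ennreal_toReal.aestronglyMeasurable c hbd'
  have key : ∀ (g : E → ℝ) (hg : MemLp g 2 μ),
      StrongDual.toWeakDual (InnerProductSpace.toDual ℝ _ (hf.toLp _)) (hg.toLp g)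
        = ∫ x, g x ∂ξ := by
    intro g hg
    change inner ℝ (hf.toLp _) (hg.toLp g) = _
    rw [L2.inner_def, ← integral_rnDeriv_smul hac]
    refine integral_congr_ae ?_
    filter_upwards [hg.coeFn_toLp, hf.coeFn_toLp] with x hx hx'
    simp [hx, hx', mul_comm]
  have hind : ∀ (A : Set E) (hA : MeasurableSet A),
      StrongDual.toWeakDual (InnerProductSpace.toDual ℝ _ (hf.toLp _))
        (indicatorConstLp 2 hA (measure_ne_top μ A) 1) = ξ.real A := by
    intro A hA
    rw [indicatorConstLp, key, integral_indicator_const _ hA]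
    simp
  refine ⟨_, ⟨?_, fun A hA => ?_, ?_⟩, key⟩
  · simp only [Set.mem_preimage, mem_closedBall_zero_iff]
    change ‖InnerProductSpace.toDual ℝ _ (hf.toLp _)‖ ≤ c
    rw [LinearIsometryEquiv.norm_map]
    -- Since `μ` has mass one, the pointwise bound `c` is also a bound on the `L²` norm; hence the
    -- radius of the ball.
    refine (Lp.norm_le_of_ae_bound hc ?_).trans (by simp [measureUnivNNReal])
    filter_upwards [hf.coeFn_toLp, hbd'] with x hx hx'
    rwa [hx]
  · rw [hind A hA]
    refine ⟨measureReal_nonneg, ?_⟩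
    have := ENNReal.toReal_mono (by simp [ENNReal.mul_eq_top]) (hle A)
    simpa [Measure.real, ENNReal.toReal_ofReal hc] using this
  · rw [Set.mem_ofPred_eq, hind]; simp

/-- The entries of `ℳ` lie in `L²`, so integrating them is weak-* continuous and the set is a
continuous image of `boundedDensities`. -/
lemma isCompact_boundedInfo {μ : Measure E} [IsProbabilityMeasure μ]
    {ℳ : E → Matrix (Fin p) (Fin p) ℝ} (hM : ∀ i j, MemLp (fun x => ℳ x i j) 2 μ) {α : ℝ}
    (hα : 0 < α) : IsCompact (boundedInfo μ ℳ α) := by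
  let T : WeakDual ℝ (Lp ℝ 2 μ) → Matrix (Fin p) (Fin p) ℝ :=
    fun φ => Matrix.of fun i j => φ ((hM i j).toLp _)
  have hT : Continuous T := continuous_matrix fun i j => WeakDual.eval_continuous _
  convert (isCompact_boundedDensities μ α⁻¹).image hT using 1
  have hα' : 0 ≤ α⁻¹ := (inv_pos.2 hα).le
  ext M
  simp only [boundedInfo, ← ENNReal.ofReal_inv_of_pos hα, Set.mem_ofPred_eq, Set.mem_image]
  constructor
  · rintro ⟨ξ, h1, hle, rfl⟩
    obtain ⟨φ, hφ, h⟩ := exists_mem_boundedDensities_of_measure hα' h1 hle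
    exact ⟨φ, hφ, by ext i j; exact h _ _⟩
  · rintro ⟨φ, hφ, rfl⟩
    obtain ⟨ξ, h1, hle, h⟩ := exists_measure_of_mem_boundedDensities hα' hφ
    exact ⟨ξ, h1, hle, by ext i j; exact h _ _⟩

lemma boundedInfo_nonempty {μ : Measure E} [IsProbabilityMeasure μ]
    {ℳ : E → Matrix (Fin p) (Fin p) ℝ} {α : ℝ} (hα : α ≤ 1) :
    (boundedInfo μ ℳ α).Nonempty := by
  refine ⟨_, μ, measure_univ, fun s => ?_, rfl⟩
  rw [Measure.smul_apply, smul_eq_mul]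
  refine le_mul_of_one_le_left zero_le ?_
  rw [ENNReal.one_le_inv]
  exact ENNReal.ofReal_le_one.2 hα

end Measures

open scoped MatrixOrder ComplexOrder in
lemma trace_mul_nonneg {n : Type*} [Fintype n] {A B : Matrix n n ℝ} (hA : A.PosSemidef)
    (hB : B.PosSemidef) : 0 ≤ (A * B).trace := by
  classical
  obtain ⟨C, rfl⟩ := CStarAlgebra.nonneg_iff_eq_star_mul_self.mp hB.nonneg
  rw [← mul_assoc, Matrix.trace_mul_comm, ← mul_assoc]
  exact (hA.mul_mul_conjTranspose_same C).trace_nonneg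

/-! ### Tangent planes, maximizers and first-order optimality. -/

section Criterion

variable {p : ℕ} {Φ : Matrix (Fin p) (Fin p) ℝ → EReal}
  {G : Matrix (Fin p) (Fin p) ℝ → Matrix (Fin p) (Fin p) ℝ}

lemma HPhi.coe_toReal (hΦ : HPhi Φ) {M : Matrix (Fin p) (Fin p) ℝ} (hM : M.PosDef) :
    ((Φ M).toReal : EReal) = Φ M :=
  EReal.coe_toReal (hΦ.ne_top M hM.posSemidef) (hΦ.ne_bot M hM)

lemma HPhi.toReal_le_toReal (hΦ : HPhi Φ) {M N : Matrix (Fin p) (Fin p) ℝ} (hM : M.PosDef)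
    (hN : N.PosDef) : (Φ M).toReal ≤ (Φ N).toReal ↔ Φ M ≤ Φ N := by
  rw [← EReal.coe_le_coe_iff, hΦ.coe_toReal hM, hΦ.coe_toReal hN]

lemma HPhi.toReal_le_add_trace (hΦ : HPhi Φ) (hG : IsGradient Φ G)
    {M₀ M : Matrix (Fin p) (Fin p) ℝ} (h₀ : M₀.PosDef) (hM : M.PosDef) :
    (Φ M).toReal ≤ (Φ M₀).toReal + (G M₀ * (M - M₀)).trace := by
  have ht := (hG M₀ h₀).2 M hM.posSemidef
  have : (Φ M).toReal - (Φ M₀).toReal ≤ (G M₀ * (M - M₀)).trace := by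
    refine ge_of_tendsto ht ?_
    filter_upwards [Ioo_mem_nhdsGT (zero_lt_one' ℝ)] with γ hγ
    rw [le_div_iff₀ hγ.1]
    have := hΦ.strictConcave.concaveOn.2 h₀ hM (sub_nonneg.2 hγ.2.le) hγ.1.le (by ring)
    simp only [smul_eq_mul] at this
    linarith
  linarith

/-- Selected matrices may be singular, where concavity is not assumed and `Φ` may be `⊥`.
Monotonicity passes to `M + ε • 1`, and then `ε → 0`. -/
lemma HPhi.le_add_trace (hΦ : HPhi Φ) (hG : IsGradient Φ G)
    {M₀ M : Matrix (Fin p) (Fin p) ℝ} (h₀ : M₀.PosDef) (hM : M.PosSemidef) :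
    Φ M ≤ (((Φ M₀).toReal + (G M₀ * (M - M₀)).trace : ℝ) : EReal) := by
  have hlim : Tendsto (fun ε : ℝ =>
      (((Φ M₀).toReal + (G M₀ * (M + ε • (1 : Matrix (Fin p) (Fin p) ℝ) - M₀)).trace : ℝ) : EReal))
      (𝓝[>] 0) (𝓝 (((Φ M₀).toReal + (G M₀ * (M - M₀)).trace : ℝ) : EReal)) := by
    refine (continuous_coe_real_ereal.tendsto _).comp ?_
    have hc : Continuous fun ε : ℝ =>
        (Φ M₀).toReal + (G M₀ * (M + ε • (1 : Matrix (Fin p) (Fin p) ℝ) - M₀)).trace := by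
      fun_prop
    simpa using (hc.tendsto 0).mono_left nhdsWithin_le_nhds
  refine ge_of_tendsto hlim ?_
  filter_upwards [self_mem_nhdsWithin] with ε hε
  have h1 : (ε • (1 : Matrix (Fin p) (Fin p) ℝ)).PosDef := Matrix.PosDef.one.smul hε
  have h2 : (M + ε • (1 : Matrix (Fin p) (Fin p) ℝ)).PosDef := h1.posSemidef_add hM
  calc Φ M ≤ Φ (M + ε • (1 : Matrix (Fin p) (Fin p) ℝ)) :=
        hΦ.increasing _ _ hM h2.posSemidef (by simpa using h1.posSemidef)
    _ = _ := (hΦ.coe_toReal h2).symm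
    _ ≤ _ := EReal.coe_le_coe_iff.2 (hΦ.toReal_le_add_trace hG h₀ h2)

/-- The tangent plane at `M₀` is a continuous majorant that touches the graph there. -/
lemma HPhi.upperSemicontinuousOn (hΦ : HPhi Φ) :
    UpperSemicontinuousOn (fun M => (Φ M).toReal)
      {M : Matrix (Fin p) (Fin p) ℝ | M.PosDef} := by
  obtain ⟨G, hG, -⟩ := hΦ.gradient
  intro M₀ h₀ y hy
  have hc : Continuous fun M => (Φ M₀).toReal + (G M₀ * (M - M₀)).trace := by fun_prop
  have hev := (hc.tendsto M₀).mono_left (nhdsWithin_le_nhds (s := {M | M.PosDef}))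
    |>.eventually_lt_const (u := y) (by simpa using hy)
  filter_upwards [hev, self_mem_nhdsWithin] with M hM hpd
  exact (hΦ.toReal_le_add_trace hG h₀ hpd).trans_lt hM

lemma HPhi.existsUnique_isMax (hΦ : HPhi Φ) {K : Set (Matrix (Fin p) (Fin p) ℝ)}
    (hne : K.Nonempty) (hK : IsCompact K) (hconv : Convex ℝ K) (hpd : ∀ M ∈ K, M.PosDef) :
    ∃! M₀, M₀ ∈ K ∧ ∀ M ∈ K, Φ M ≤ Φ M₀ := by
  obtain ⟨M₀, h₀, hmax⟩ := (hΦ.upperSemicontinuousOn.mono hpd).exists_isMaxOn hne hK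
  refine ⟨M₀, ⟨h₀, fun M hM => (hΦ.toReal_le_toReal (hpd M hM) (hpd _ h₀)).1 (hmax hM)⟩, ?_⟩
  rintro M₁ ⟨h₁, hmax₁⟩
  refine (hΦ.strictConcave.subset hpd hconv).eq_of_isMaxOn (fun M hM => ?_) hmax h₁ h₀
  exact (hΦ.toReal_le_toReal (hpd M hM) (hpd _ h₁)).2 (hmax₁ M hM)

lemma HPhi.trace_le_zero_of_isMax (hΦ : HPhi Φ) (hG : IsGradient Φ G)
    {K : Set (Matrix (Fin p) (Fin p) ℝ)} (hconv : Convex ℝ K) (hpd : ∀ M ∈ K, M.PosDef)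
    {M₀ M : Matrix (Fin p) (Fin p) ℝ} (h₀ : M₀ ∈ K) (hmax : ∀ N ∈ K, Φ N ≤ Φ M₀) (hM : M ∈ K) :
    (G M₀ * (M - M₀)).trace ≤ 0 := by
  refine le_of_tendsto ((hG M₀ (hpd _ h₀)).2 M (hpd _ hM).posSemidef) ?_
  filter_upwards [Ioo_mem_nhdsGT (zero_lt_one' ℝ)] with γ hγ
  have hmem := hconv h₀ hM (sub_nonneg.2 hγ.2.le) hγ.1.le (by ring)
  refine div_nonpos_of_nonpos_of_nonneg (sub_nonpos.2 ?_) hγ.1.le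
  exact (hΦ.toReal_le_toReal (hpd _ hmem) (hpd _ h₀)).2 (hmax _ hmem)

end Criterion

/-! ### Upper quantiles and the best fraction `α` of `μ`. -/

section Quantile

variable {E : Type*} [MeasurableSpace E]

lemma exists_quantile {μ : Measure E} [IsProbabilityMeasure μ] {g : E → ℝ} (hg : Measurable g)
    (hg0 : ∀ x, 0 ≤ g x) {α : ℝ} (hα0 : 0 < α) (hα : α < 1) :
    ∃ c : ℝ, μ.real {x | c < g x} ≤ α ∧ α ≤ μ.real {x | c ≤ g x} := by
  have hm : ∀ t, MeasurableSet {x | t < g x} := fun t => measurableSet_lt measurable_const hg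
  -- The quantile is `sInf T`; approaching it from above and from below gives the two inequalities.
  set T : Set ℝ := {t | μ.real {x | t < g x} ≤ α} with hT
  have hne : T.Nonempty := by
    have hanti : Antitone fun n : ℕ => {x | (n : ℝ) < g x} :=
      fun m n hmn x (hx : (n : ℝ) < g x) => (Nat.cast_le.2 hmn : (m : ℝ) ≤ n).trans_lt hx
    have hlim := tendsto_measure_iInter_atTop (μ := μ)
      (fun n : ℕ => (hm n).nullMeasurableSet) hanti ⟨0, measure_ne_top _ _⟩
    have hemp : ⋂ n : ℕ, {x | (n : ℝ) < g x} = ∅ := by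
      refine Set.eq_empty_of_forall_notMem fun x hx => ?_
      obtain ⟨n, hn⟩ := exists_nat_ge (g x)
      exact absurd (Set.mem_iInter.1 hx n) (not_lt.2 hn)
    rw [hemp, measure_empty] at hlim
    obtain ⟨n, hn⟩ := (hlim.eventually_lt_const (ENNReal.ofReal_pos.2 hα0)).exists
    exact ⟨n, ENNReal.toReal_le_of_le_ofReal hα0.le hn.le⟩
  have hlb : ∀ t ∈ T, 0 ≤ t := fun t ht => by
    by_contra! h
    have : {x | t < g x} = Set.univ := Set.eq_univ_of_forall fun x => h.trans_le (hg0 x)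
    have h1 : μ.real {x | t < g x} ≤ α := ht
    rw [this, probReal_univ] at h1
    linarith
  have hbdd : BddBelow T := ⟨0, hlb⟩
  have hup : ∀ t, sInf T < t → μ.real {x | t < g x} ≤ α := fun t ht => by
    obtain ⟨s, hs, hst⟩ := exists_lt_of_csInf_lt hne ht
    exact (measureReal_mono fun x hx => hst.trans hx).trans hs
  have hdown : ∀ t, t < sInf T → α ≤ μ.real {x | t < g x} := fun t ht => by
    by_contra! h
    exact absurd (csInf_le hbdd (show t ∈ T from h.le)) (not_le.2 ht)
  obtain ⟨u, hu, hul, hut⟩ := exists_seq_strictAnti_tendsto (sInf T)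
  obtain ⟨v, hv, hvl, hvt⟩ := exists_seq_strictMono_tendsto (sInf T)
  refine ⟨sInf T, ?_, ?_⟩
  · have hmono : Monotone fun n : ℕ => {x | u n < g x} := fun m n hmn x hx =>
      lt_of_le_of_lt (hu.antitone hmn) hx
    have hlim := tendsto_measure_iUnion_atTop (μ := μ) hmono
    have heq : ⋃ n, {x | u n < g x} = {x | sInf T < g x} := by
      ext x
      simp only [Set.mem_iUnion, Set.mem_ofPred_eq]
      exact ⟨fun ⟨n, hn⟩ => (hul n).trans hn, fun h => (hut.eventually_lt_const h).exists⟩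
    rw [heq] at hlim
    have h2 := le_of_tendsto' hlim fun n => (ENNReal.le_ofReal_iff_toReal_le
      (measure_ne_top _ _) hα0.le).2 (hup _ (hul n))
    exact ENNReal.toReal_le_of_le_ofReal hα0.le h2
  · have hanti : Antitone fun n : ℕ => {x | v n < g x} := fun m n hmn x hx =>
      lt_of_le_of_lt (hv.monotone hmn) hx
    have hlim := tendsto_measure_iInter_atTop (μ := μ)
      (fun n : ℕ => (hm (v n)).nullMeasurableSet) hanti ⟨0, measure_ne_top _ _⟩
    have heq : ⋂ n, {x | v n < g x} = {x | sInf T ≤ g x} := by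
      ext x
      simp only [Set.mem_iInter, Set.mem_ofPred_eq]
      exact ⟨fun h => le_of_tendsto' hvt fun n => (h n).le,
        fun h n => (hvl n).trans_le h⟩
    rw [heq] at hlim
    have h2 := ge_of_tendsto' hlim fun n => (ENNReal.ofReal_le_iff_le_toReal
      (measure_ne_top _ _)).2 (hdown _ (hvl n))
    exact (ENNReal.ofReal_le_iff_le_toReal (measure_ne_top _ _)).1 h2

/-- The mean of `g` over the best fraction `α` of `μ` equals `c + E[(g - c)⁺] / α`, for `c` an
upper `α`-quantile of `g`. -/
lemma exists_measure_integral_eq {μ : Measure E} [IsProbabilityMeasure μ] {g : E → ℝ}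
    (hg : Measurable g) (hg0 : ∀ x, 0 ≤ g x) (hgi : Integrable g μ) {α : ℝ} (hα0 : 0 < α)
    (hα : α < 1) :
    ∃ (c : ℝ) (ξ : Measure E), ξ Set.univ = 1 ∧ ξ ≤ (ENNReal.ofReal α)⁻¹ • μ ∧
      ∫ x, g x ∂ξ = c + (∫ x, max (g x - c) 0 ∂μ) / α := by
  obtain ⟨c, hc1, hc2⟩ := exists_quantile (μ := μ) hg hg0 hα0 hα
  set U : Set E := {x | c < g x} with hU
  set V : Set E := {x | g x = c} with hV
  have hUm : MeasurableSet U := measurableSet_lt measurable_const hg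
  have hVm : MeasurableSet V := hg (measurableSet_singleton c)
  have hdisj : Disjoint U V := Set.disjoint_left.2 fun x hx hy => (ne_of_gt hx) hy
  have hUV : μ.real {x | c ≤ g x} = μ.real U + μ.real V := by
    rw [← measureReal_union hdisj hVm]
    congr 1
    ext x
    simp only [hU, hV, Set.mem_ofPred_eq, Set.mem_union, le_iff_lt_or_eq, eq_comm]
  rw [hUV] at hc2
  -- The level set `V` may carry mass, so only a fraction `θ` of it is kept, to reach total mass
  -- exactly `α`.
  obtain ⟨θ, hθ0, hθ1, hθ⟩ : ∃ θ : ℝ, 0 ≤ θ ∧ θ ≤ 1 ∧ μ.real U + θ * μ.real V = α := by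
    rcases eq_or_lt_of_le (measureReal_nonneg (μ := μ) (s := V)) with h | h
    · exact ⟨0, le_rfl, zero_le_one, by linarith⟩
    · exact ⟨(α - μ.real U) / μ.real V, div_nonneg (by linarith) h.le,
        (div_le_one h).2 (by linarith), by field_simp; ring⟩
  have hi : ∀ s, Integrable g (μ.restrict s) := fun s => hgi.restrict
  refine ⟨c, (ENNReal.ofReal α)⁻¹ • (μ.restrict U + ENNReal.ofReal θ • μ.restrict V), ?_, ?_, ?_⟩
  · have : μ U + ENNReal.ofReal θ * μ V = ENNReal.ofReal α := by
      rw [← hθ, ENNReal.ofReal_add measureReal_nonneg (by positivity), ENNReal.ofReal_mul hθ0,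
        ofReal_measureReal, ofReal_measureReal]
    simp only [Measure.smul_apply, Measure.add_apply, Measure.restrict_apply_univ, smul_eq_mul,
      this]
    exact ENNReal.inv_mul_cancel (ENNReal.ofReal_pos.2 hα0).ne' ENNReal.ofReal_ne_top
  · gcongr
    calc μ.restrict U + ENNReal.ofReal θ • μ.restrict V
        ≤ μ.restrict U + (1 : ENNReal) • μ.restrict V := by
          gcongr; exact ENNReal.ofReal_le_one.2 hθ1
      _ = μ.restrict (U ∪ V) := by rw [one_smul, Measure.restrict_union hdisj hVm]
      _ ≤ μ := Measure.restrict_le_self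
  · have h1 : ∫ x, max (g x - c) 0 ∂μ = ∫ x in U, g x ∂μ - c * μ.real U := by
      have : (fun x => max (g x - c) 0) = U.indicator fun x => g x - c := by
        ext x
        by_cases hx : x ∈ U
        · rw [Set.indicator_of_mem hx]; exact max_eq_left (sub_nonneg.2 (le_of_lt hx))
        · rw [Set.indicator_of_notMem hx]; exact max_eq_right (sub_nonpos.2 (not_lt.1 hx))
      rw [this, integral_indicator hUm, integral_sub (hi U) (integrable_const _)]
      simp [mul_comm]
    have h2 : ∫ x in V, g x ∂μ = c * μ.real V := by
      rw [setIntegral_congr_fun hVm (g := fun _ => c) fun x hx => hx]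
      simp [mul_comm]
    rw [integral_smul_measure, integral_add_measure (hi U)
      ((hi V).smul_measure ENNReal.ofReal_ne_top), integral_smul_measure, h1, h2,
      ENNReal.toReal_inv, ENNReal.toReal_ofReal hα0.le, ENNReal.toReal_ofReal hθ0]
    simp only [smul_eq_mul]
    field_simp
    linear_combination c * hθ

end Quantile

/-! ### The bound along a fixed sample path. -/

lemma sum_le_card_mul_add_sum_max {ι : Type*} {S T : Finset ι} (h : S ⊆ T) (f : ι → ℝ) (c : ℝ) :
    ∑ i ∈ S, f i ≤ S.card * c + ∑ i ∈ T, max (f i - c) 0 := by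
  calc ∑ i ∈ S, f i ≤ ∑ i ∈ S, (c + max (f i - c) 0) :=
        Finset.sum_le_sum fun i _ => by linarith [le_max_left (f i - c) 0]
    _ = S.card * c + ∑ i ∈ S, max (f i - c) 0 := by simp [Finset.sum_add_distrib]
    _ ≤ _ := by
        gcongr

lemma posSemidef_selectedInfo {E : Type*} {p : ℕ} {ℳ : E → Matrix (Fin p) (Fin p) ℝ}
    (hpsd : ∀ x, (ℳ x).PosSemidef) (x : ℕ → E) (S : Finset ℕ) :
    (selectedInfo ℳ x S).PosSemidef :=
  (Matrix.posSemidef_sum _ fun i _ => hpsd (x i)).smul (by positivity)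

lemma limsup_selectedInfo_le {E : Type*} {p : ℕ} {Φ : Matrix (Fin p) (Fin p) ℝ → EReal}
    {G : Matrix (Fin p) (Fin p) ℝ → Matrix (Fin p) (Fin p) ℝ} (hΦ : HPhi Φ)
    (hG : IsGradient Φ G) {ℳ : E → Matrix (Fin p) (Fin p) ℝ} (hpsd : ∀ x, (ℳ x).PosSemidef)
    {M₀ : Matrix (Fin p) (Fin p) ℝ} (h₀ : M₀.PosDef) {α c m : ℝ} (hα : 0 < α)
    (hcm : c + m / α ≤ (G M₀ * M₀).trace) {x : ℕ → E}
    (hx : Tendsto (fun k : ℕ => (∑ i ∈ Finset.range k, max ((G M₀ * ℳ (x i)).trace - c) 0) / k)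
      atTop (𝓝 m)) {n : ℕ → ℕ} {S : ℕ → Finset ℕ}
    (hn : Tendsto (fun k => (n k : ℝ) / (k : ℝ)) atTop (𝓝 α))
    (hS : ∀ k, S k ⊆ Finset.range k ∧ (S k).card = n k) :
    limsup (fun k => Φ (selectedInfo ℳ x (S k))) atTop ≤ Φ M₀ := by
  set b : ℕ → ℝ := fun k => (Φ M₀).toReal + (c +
    (∑ i ∈ Finset.range k, max ((G M₀ * ℳ (x i)).trace - c) 0) / k / (n k / k)
      - (G M₀ * M₀).trace) with hb
  have hlim : Tendsto b atTop (𝓝 ((Φ M₀).toReal + (c + m / α - (G M₀ * M₀).trace))) :=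
    (((hx.div hn hα.ne').const_add c).sub_const _).const_add _
  have hlim' := (continuous_coe_real_ereal.tendsto _).comp hlim
  calc limsup (fun k => Φ (selectedInfo ℳ x (S k))) atTop
      ≤ limsup (fun k => (b k : EReal)) atTop := by
        refine limsup_le_limsup ?_
        -- A positive ratio forces `k` and `n k` to be nonzero, so no division by zero remains.
        filter_upwards [hn.eventually_const_lt hα] with k hk
        have hk0 : (k : ℝ) ≠ 0 := fun h => by simp [h] at hk
        have hn0 : (0 : ℝ) < n k := by
          refine (Nat.cast_nonneg _).lt_of_ne' fun h => ?_
          simp [h] at hk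
        refine (hΦ.le_add_trace hG h₀ (posSemidef_selectedInfo hpsd x (S k))).trans ?_
        rw [EReal.coe_le_coe_iff, Matrix.mul_sub, Matrix.trace_sub, selectedInfo, Matrix.mul_smul,
          Matrix.trace_smul, Matrix.mul_sum, Matrix.trace_sum, (hS k).2, hb, smul_eq_mul]
        have h := sum_le_card_mul_add_sum_max (hS k).1 (fun i => (G M₀ * ℳ (x i)).trace) c
        rw [(hS k).2] at h
        dsimp only
        rw [div_div_div_cancel_right₀ hk0]
        gcongr
        calc _ ≤ _ := mul_le_mul_of_nonneg_left h (inv_pos.2 hn0).le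
          _ = _ := by field_simp
    _ = _ := hlim'.limsup_eq
    _ ≤ ((Φ M₀).toReal : EReal) := EReal.coe_le_coe_iff.2 (by linarith)
    _ = Φ M₀ := hΦ.coe_toReal h₀

end BoundedDesign

theorem mainTheorem3 {d p : ℕ} (hp : 1 < p)
    (𝒳 : Set (EuclideanSpace ℝ (Fin d))) (μ : Measure 𝒳) [IsProbabilityMeasure μ]
    (ℳ : 𝒳 → Matrix (Fin p) (Fin p) ℝ) (hpsd : ∀ x, (ℳ x).PosSemidef)
    (Φ : Matrix (Fin p) (Fin p) ℝ → EReal)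
    (hΦ : BoundedDesign.HPhi Φ) (hM : BoundedDesign.HM μ ℳ)
    {Ω : Type*} [MeasurableSpace Ω] (P : Measure Ω) [IsProbabilityMeasure P]
    (X : ℕ → Ω → 𝒳) (hXmeas : ∀ i, Measurable (X i)) (hXindep : iIndepFun X P)
    (hXlaw : ∀ i, P.map (X i) = μ)
    (α : ℝ) (hα : α ∈ Set.Ioo (0 : ℝ) 1) :
    (∃! Mopt, BoundedDesign.IsOptimal Φ μ ℳ α Mopt) ∧
    ∀ Mopt, BoundedDesign.IsOptimal Φ μ ℳ α Mopt →
      ∀ᵐ ω ∂P, ∀ (n : ℕ → ℕ) (S : ℕ → Finset ℕ),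
        Tendsto (fun k => (n k : ℝ) / (k : ℝ)) atTop (𝓝 α) →
        (∀ k, S k ⊆ Finset.range k ∧ (S k).card = n k) →
        limsup (fun k => Φ (BoundedDesign.selectedInfo ℳ (fun i => X i ω) (S k))) atTop
          ≤ Φ Mopt := by
  have hint : ∀ i j, Integrable (fun x => ℳ x i j) μ := fun i j =>
    (hM.memLp i j).integrable one_le_two
  have hconv := BoundedDesign.convex_boundedInfo hint hα.1
  have hpd : ∀ M ∈ BoundedDesign.boundedInfo μ ℳ α, M.PosDef := by
    rintro _ ⟨ξ, h1, hle, rfl⟩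
    rw [← ENNReal.ofReal_inv_of_pos hα.1] at hle
    exact BoundedDesign.posDef_infoMatrix hpsd hM h1 hle
  refine ⟨hΦ.existsUnique_isMax (BoundedDesign.boundedInfo_nonempty hα.2.le)
    (BoundedDesign.isCompact_boundedInfo hM.memLp hα.1) hconv hpd, fun M₀ h₀ => ?_⟩
  obtain ⟨G, hG, -⟩ := hΦ.gradient
  have hM₀ := hpd M₀ h₀.1
  have hgm : Measurable fun x => (G M₀ * ℳ x).trace :=
    (continuous_const.matrix_mul hM.continuous).matrix_trace.measurable
  have hg0 : ∀ x, 0 ≤ (G M₀ * ℳ x).trace := fun x =>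
    BoundedDesign.trace_mul_nonneg (hG M₀ hM₀).1 (hpsd x)
  have hgi := BoundedDesign.integrable_trace_mul hint (G M₀)
  obtain ⟨c, ξ, hξ1, hξle, hξ⟩ :=
    BoundedDesign.exists_measure_integral_eq hgm hg0 hgi hα.1 hα.2
  have hopt := hΦ.trace_le_zero_of_isMax hG hconv hpd h₀.1 h₀.2 ⟨ξ, hξ1, hξle, rfl⟩
  rw [← ENNReal.ofReal_inv_of_pos hα.1] at hξle
  rw [Matrix.mul_sub, Matrix.trace_sub, BoundedDesign.trace_mul_infoMatrix
    (fun i j => BoundedDesign.integrable_of_le_smul hξle (hint i j)), hξ] at hopt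
  set h : 𝒳 → ℝ := fun x => max ((G M₀ * ℳ x).trace - c) 0 with hh
  have hhm : Measurable h := (hgm.sub_const c).max measurable_const
  have hhi : Integrable h μ := (hgi.sub (integrable_const c)).pos_part
  have hslln := strong_law_ae_real (μ := P) (fun i => h ∘ X i)
    (by rw [← hXlaw 0] at hhi; exact hhi.comp_measurable (hXmeas 0))
    (fun i j hij => (hXindep.indepFun hij).comp hhm hhm)
    (fun i => (IdentDistrib.mk (hXmeas i).aemeasurable (hXmeas 0).aemeasurable
      (by rw [hXlaw, hXlaw])).comp hhm)
  have hmean : ∫ ω, (h ∘ X 0) ω ∂P = ∫ x, h x ∂μ := by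
    rw [← hXlaw 0, integral_map (hXmeas 0).aemeasurable hhm.aestronglyMeasurable]
    rfl
  rw [hmean] at hslln
  -- The null set depends only on `g` and `c`, so one event serves all choices of `n` and `S`.
  filter_upwards [hslln] with ω hω n S hn hS
  exact BoundedDesign.limsup_selectedInfo_le hΦ hG hpsd hM₀ hα.1 (sub_nonpos.1 hopt) hω hn hS
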